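/- For $n\ge 1$ let $H(n)=1+\frac12+\cdots+\frac1n$ be the $n$-th harmonic number, and let $\nu_p$ denote the $p$-adic valuation on $\mathbb{Q}$. A prime $p$ is called a Wolstenholme prime if $p$ divides the numerator of the Bernoulli number $B_{p-3}$. Here $\mathbb{N}=\{0,1,2,\dots\}$. Let $p\ge 5$ be a Wolstenholme prime and let $n$ be a positive integer such that $p\nmid n$ and $\nu_p(H(n))\ge 3$. 1. If $\nu_p(H(n))=3$, then $\nu_p(H(pn))=2$, and from there on the valuation drops by one at each step: $\nu_p(H(p^m\cdot pn))=2-m$ for all $m\in\mathbb{N}$. 2. If $\nu_p(H(n))\ge 4$ and there is no $m\in\mathbb{N}$ with $\nu_p(H(p^mn))\le 3$, then $\nu_p(H(p^mn))\ge 2m+4$ for all $m\in\mathbb{N}$. 3. If $\nu_p(H(n))\ge 4$ and there is an $m\in\mathbb{N}$ with $\nu_p(H(p^mn))\le 3$, then there exists $M\in\mathbb{N}$ such that $\nu_p(H(p^Mn))=0$ and, for all $m\in\mathbb{N}$, \[ \begin{cases} \nu_p(H(p^mn))\ge 2m+4 & \text{if } m\le \frac{M-1}{3}-1,\\ \nu_p(H(p^mn))=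 M-m & \text{if } m> \frac{M-1}{3}-1. \end{cases} \] -/

import Mathlib

/-- A Wolstenholme prime: a prime `p` dividing (the numerator of) the Bernoulli number `B_{p-3}`.
For `p = 2, 3` the truncated index is `0` and `B_0 = 1`, so neither is a Wolstenholme prime. -/
def IsWolstenholmePrime (p : ℕ) : Prop :=
  p.Prime ∧ (p : ℤ) ∣ (bernoulli (p - 3)).num

/-!
Write `R(N)` for the sum of the reciprocals of the `k < N` prime to `p`. Separating the multiples of
`p` gives `H(pN) = H(N) / p + R(pN)`, so everything rests on the bound
`ν_p(R(p ^ (m + 1) * n)) ≥ 2m + 3`: as long as `ν_p(H(p ^ m * n)) ≤ 2m + 3` the first summand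
dominates and the valuation drops by one, which then repeats forever, while a larger valuation
falls to no less than `2m + 3` in one step. The first crossing therefore determines the whole
sequence.

Pairing `k` with `N - k` and expanding `1 / (N - k)` in powers of `N` gives
`2 R(N) ≡ -N ∑ 1 / k² (mod N³)`, and expanding over blocks of length `p ^ a` lifts `∑_{k<p} 1 / k²`
to `N = p ^ a * n` at the gain of one factor `p` per step. Finally `∑_{k<p} 1 / k² ≡ 0 (mod p²)` is
the Wolstenholme condition: by Faulhaber's formula `∑_{k<p} k ^ (p - 3) ≡ p B_{p-3} (mod p²)`, and
`3 k⁻² ≡ 2 k ^ (p - 3) + k ^ (-2p) (mod p²)`, where the sum of the `k ^ (-2p)` vanishes because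
`k ^ (-2p)` modulo `p²` depends only on `k` modulo `p`, so that doubling `k` multiplies the sum by
`4 ^ (-p) ≢ 1`.
-/

open Finset
open scoped Ring

section FiniteSums

theorem sum_range_mul_eq_sum_blocks {M : Type*} [AddCommMonoid M] (f : ℕ → M) (L m : ℕ) :
    ∑ k ∈ range (L * m), f k = ∑ j ∈ range m, ∑ i ∈ range L, f (i + L * j) := by
  induction m with
  | zero => simp
  | succ m ih =>
    rw [Nat.mul_succ, sum_range_add, ih, sum_range_succ]
    simp only [add_comm]

theorem sum_range_sub_of_eq {M : Type*} [AddCancelCommMonoid M] {f : ℕ → M} {N : ℕ}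
    (h : f 0 = f N) : ∑ k ∈ range N, f (N - k) = ∑ k ∈ range N, f k := by
  have hflip := sum_flip f (n := N)
  rw [sum_range_succ, sum_range_succ, Nat.sub_self, h] at hflip
  exact add_right_cancel hflip

theorem sum_range_mul_mod {M : Type*} [AddCommMonoid M] {N c : ℕ} (hc : N.Coprime c)
    (f : ℕ → M) : ∑ i ∈ range N, f (c * i % N) = ∑ i ∈ range N, f i := by
  have hmaps : Set.MapsTo (fun i ↦ c * i % N) (range N) (range N) := fun i hi ↦
    mem_range.2 (Nat.mod_lt _ (Nat.zero_lt_of_lt (mem_range.1 hi)))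
  have hinj : Set.InjOn (fun i ↦ c * i % N) (range N) := fun i hi j hj hij ↦
    (Nat.ModEq.cancel_left_of_coprime hc hij).eq_of_lt_of_lt (mem_range.1 hi) (mem_range.1 hj)
  exact sum_nbij _ hmaps hinj (surjOn_of_injOn_of_card_le _ hmaps hinj le_rfl) fun _ _ ↦ rfl

end FiniteSums

section RingInverse

theorem ringInverse_neg {R : Type*} [Ring R] (x : R) : (-x)⁻¹ʳ = -x⁻¹ʳ := by
  by_cases hx : IsUnit x
  · obtain ⟨u, rfl⟩ := hx
    rw [← Units.val_neg, Ring.inverse_unit, Ring.inverse_unit, inv_neg, Units.val_neg]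
  · rw [Ring.inverse_non_unit _ hx, Ring.inverse_non_unit _ (by rwa [IsUnit.neg_iff]), neg_zero]

variable {R : Type*} [CommRing R] [IsLocalRing R] {x y : R}

theorem isUnit_add_iff_of_mem_nonunits (hy : y ∈ nonunits R) : IsUnit (x + y) ↔ IsUnit x := by
  refine ⟨fun h ↦ (IsLocalRing.isUnit_or_isUnit_of_isUnit_add h).resolve_right hy, fun h ↦ ?_⟩
  rw [← add_neg_cancel_right x y] at h
  exact (IsLocalRing.isUnit_or_isUnit_of_isUnit_add h).resolve_right fun hy' ↦
    hy ((IsUnit.neg_iff y).1 hy')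

theorem ringInverse_add (hy : y ∈ nonunits R) :
    (x + y)⁻¹ʳ = x⁻¹ʳ - y * x⁻¹ʳ * (x + y)⁻¹ʳ := by
  by_cases hx : IsUnit x
  · have hxu := Ring.mul_inverse_cancel _ hx
    have hxyu := Ring.mul_inverse_cancel _ ((isUnit_add_iff_of_mem_nonunits hy).2 hx)
    linear_combination x⁻¹ʳ * hxyu - (x + y)⁻¹ʳ * hxu
  · rw [Ring.inverse_non_unit _ hx,
      Ring.inverse_non_unit _ (mt (isUnit_add_iff_of_mem_nonunits hy).1 hx)]
    ring

theorem dvd_ringInverse_add_sub (hy : y ∈ nonunits R) : y ∣ (x + y)⁻¹ʳ - x⁻¹ʳ :=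
  ⟨-(x⁻¹ʳ * (x + y)⁻¹ʳ), by linear_combination ringInverse_add (x := x) hy⟩

theorem cube_dvd_ringInverse_add_sub (hy : y ∈ nonunits R) :
    y ^ 3 ∣ (x + y)⁻¹ʳ - (x⁻¹ʳ - y * x⁻¹ʳ ^ 2 + y ^ 2 * x⁻¹ʳ ^ 3) :=
  ⟨-(x⁻¹ʳ ^ 3 * (x + y)⁻¹ʳ), by
    linear_combination (1 - y * x⁻¹ʳ + y ^ 2 * x⁻¹ʳ ^ 2) * ringInverse_add (x := x) hy⟩

theorem cube_dvd_ringInverse_add_sq_sub (hy : y ∈ nonunits R) :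
    y ^ 3 ∣ (x + y)⁻¹ʳ ^ 2 - (x⁻¹ʳ ^ 2 - 2 * y * x⁻¹ʳ ^ 3 + 3 * y ^ 2 * x⁻¹ʳ ^ 4) := by
  obtain ⟨w, hw⟩ := cube_dvd_ringInverse_add_sub (x := x) hy
  exact ⟨-2 * x⁻¹ʳ ^ 5 + y * x⁻¹ʳ ^ 6 + w * ((x + y)⁻¹ʳ + (x⁻¹ʳ - y * x⁻¹ʳ ^ 2 + y ^ 2 * x⁻¹ʳ ^ 3)),
    by linear_combination ((x + y)⁻¹ʳ + (x⁻¹ʳ - y * x⁻¹ʳ ^ 2 + y ^ 2 * x⁻¹ʳ ^ 3)) * hw⟩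

end RingInverse

section PadicInt

variable {p : ℕ} [hp : Fact p.Prime]

theorem padicInt_mem_nonunits_iff_dvd {x : ℤ_[p]} : x ∈ nonunits ℤ_[p] ↔ (p : ℤ_[p]) ∣ x := by
  rw [PadicInt.mem_nonunits, PadicInt.norm_lt_one_iff_dvd]

theorem padicInt_natCast_mem_nonunits_iff {k : ℕ} : (k : ℤ_[p]) ∈ nonunits ℤ_[p] ↔ p ∣ k := by
  rw [PadicInt.mem_nonunits, PadicInt.norm_natCast_lt_one_iff]

theorem padicInt_isUnit_natCast_iff {k : ℕ} : IsUnit (k : ℤ_[p]) ↔ ¬p ∣ k :=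
  (not_iff_comm.1 padicInt_natCast_mem_nonunits_iff).symm

theorem padicInt_isUnit_two (hp2 : p ≠ 2) : IsUnit (2 : ℤ_[p]) := by
  exact_mod_cast padicInt_isUnit_natCast_iff.2
    (mt (Nat.prime_dvd_prime_iff_eq hp.out Nat.prime_two).1 hp2)

theorem padicInt_coe_inverse_natCast (k : ℕ) :
    (((k : ℤ_[p])⁻¹ʳ : ℤ_[p]) : ℚ_[p]) = if p ∣ k then 0 else (k : ℚ_[p])⁻¹ := by
  split_ifs with h
  · rw [Ring.inverse_non_unit _ (padicInt_natCast_mem_nonunits_iff.2 h), PadicInt.coe_zero]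
  · refine eq_inv_of_mul_eq_one_right ?_
    rw [← PadicInt.coe_natCast, ← PadicInt.coe_mul,
      Ring.mul_inverse_cancel _ (padicInt_isUnit_natCast_iff.2 h), PadicInt.coe_one]

theorem padicInt_dvd_of_coe_eq_ratCast {x : ℤ_[p]} {q : ℚ} (hx : (x : ℚ_[p]) = q)
    (hq : (p : ℤ) ∣ q.num) : (p : ℤ_[p]) ∣ x := by
  have hden : ¬(p : ℤ_[p]) ∣ q.den := by
    rw [← padicInt_mem_nonunits_iff_dvd, padicInt_natCast_mem_nonunits_iff]
    exact fun h ↦ Nat.not_coprime_of_dvd_of_dvd hp.out.one_lt (Int.natCast_dvd.1 hq) h q.reduced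
  have hnum : x * q.den = q.num := PadicInt.ext <| by
    push_cast
    rw [hx]
    exact_mod_cast Rat.mul_den_eq_num q
  have hdvd : (p : ℤ_[p]) ∣ x * q.den := by
    rw [hnum]
    exact_mod_cast map_dvd (Int.castRingHom ℤ_[p]) hq
  exact (PadicInt.prime_p.dvd_or_dvd hdvd).resolve_right hden

end PadicInt

section Faulhaber

variable {p : ℕ} [hp : Fact p.Prime]

theorem exists_padicInt_coe_eq {x : ℚ_[p]} (hx : x ∈ PadicInt.subring p) :
    ∃ y : ℤ_[p], (y : ℚ_[p]) = x :=
  ⟨⟨x, hx⟩, rfl⟩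

theorem inv_natCast_mem_padicInt_subring {k : ℕ} (hk : ¬p ∣ k) :
    (k : ℚ_[p])⁻¹ ∈ PadicInt.subring p := by
  have h := (((k : ℤ_[p])⁻¹ʳ : ℤ_[p])).2
  rwa [padicInt_coe_inverse_natCast, if_neg hk] at h

theorem bernoulli_mem_padicInt_subring {n : ℕ} (hn : n + 1 < p) :
    (bernoulli n : ℚ_[p]) ∈ PadicInt.subring p := by
  induction n using Nat.strong_induction_on with
  | _ n ih =>
    have hrec : (bernoulli n : ℚ_[p]) = ((if n + 1 = 1 then 1 else 0) -
        ∑ k ∈ range n, ((n + 1).choose k : ℚ_[p]) * bernoulli k) * ((n + 1 : ℕ) : ℚ_[p])⁻¹ := by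
      rw [eq_mul_inv_iff_mul_eq₀ (Nat.cast_ne_zero.2 n.succ_ne_zero), eq_sub_iff_add_eq']
      have h := sum_bernoulli (n + 1)
      rw [sum_range_succ, Nat.choose_succ_self_right] at h
      simpa [mul_comm, apply_ite (Rat.cast : ℚ → ℚ_[p])] using congrArg (Rat.cast : ℚ → ℚ_[p]) h
    rw [hrec]
    refine mul_mem (sub_mem ?_ (sum_mem fun k hk ↦ ?_))
      (inv_natCast_mem_padicInt_subring (Nat.not_dvd_of_pos_of_lt n.succ_pos hn))
    · split_ifs <;> simp only [one_mem, zero_mem]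
    · exact mul_mem (natCast_mem _ _) (ih k (mem_range.1 hk) (by grind))

theorem sq_dvd_sum_range_pow_sub {e : ℕ} {b : ℤ_[p]} (hb : (b : ℚ_[p]) = bernoulli e)
    (he : e + 1 < p) (N : ℕ) :
    (N : ℤ_[p]) ^ 2 ∣ ∑ k ∈ range N, (k : ℤ_[p]) ^ e - N * b := by
  have hmem : ∑ i ∈ range e, (bernoulli i : ℚ_[p]) * ((e + 1).choose i : ℕ) *
      (N : ℚ_[p]) ^ (e - 1 - i) * ((e + 1 : ℕ) : ℚ_[p])⁻¹ ∈ PadicInt.subring p :=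
    sum_mem fun i hi ↦ mul_mem (mul_mem (mul_mem
      (bernoulli_mem_padicInt_subring (by grind)) (natCast_mem _ _))
      (pow_mem (natCast_mem _ _) _))
      (inv_natCast_mem_padicInt_subring (Nat.not_dvd_of_pos_of_lt e.succ_pos he))
  obtain ⟨w, hw⟩ := exists_padicInt_coe_eq hmem
  refine ⟨w, PadicInt.ext ?_⟩
  have hfaulhaber := congrArg (Rat.cast : ℚ → ℚ_[p]) (sum_range_pow N e)
  have he0 : (e : ℚ_[p]) + 1 ≠ 0 := by exact_mod_cast e.succ_ne_zero
  rw [sum_range_succ, Nat.choose_succ_self_right, Nat.add_sub_cancel_left] at hfaulhaber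
  push_cast [PadicInt.coe_sum] at hfaulhaber ⊢
  rw [hfaulhaber, hb, hw, mul_sum, add_sub_assoc, add_eq_left.2 (by field_simp; ring)]
  refine sum_congr rfl fun i hi ↦ ?_
  rw [show e + 1 - i = 2 + (e - 1 - i) by grind, pow_add]
  push_cast
  ring

theorem natCast_dvd_sum_range_pow {e : ℕ} (he : e + 1 < p) (N : ℕ) :
    (N : ℤ_[p]) ∣ ∑ k ∈ range N, (k : ℤ_[p]) ^ e := by
  obtain ⟨b, hb⟩ := exists_padicInt_coe_eq (bernoulli_mem_padicInt_subring he)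
  exact (dvd_sub_left (dvd_mul_right _ _)).1
    ((dvd_pow_self _ two_ne_zero).trans (sq_dvd_sum_range_pow_sub hb he N))

theorem sq_dvd_sum_range_pow_of_dvd_bernoulli {e : ℕ} (he : e + 1 < p)
    (hB : (p : ℤ) ∣ (bernoulli e).num) : (p : ℤ_[p]) ^ 2 ∣ ∑ k ∈ range p, (k : ℤ_[p]) ^ e := by
  obtain ⟨b, hb⟩ := exists_padicInt_coe_eq (bernoulli_mem_padicInt_subring he)
  refine (dvd_sub_left ?_).1 (sq_dvd_sum_range_pow_sub hb he p)
  rw [sq]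
  exact mul_dvd_mul_left _ (padicInt_dvd_of_coe_eq_ratCast hb hB)

end Faulhaber

/-- The `p`-restricted generalized harmonic number `∑ k⁻ˢ` over the `k < N` prime to `p`, as a
`p`-adic integer. For `s ≠ 0` the multiples of `p` drop out because `Ring.inverse` sends the
non-units of `ℤ_[p]` to `0`. -/
noncomputable def restrictedHarmonic (p : ℕ) [Fact p.Prime] (s N : ℕ) : ℤ_[p] :=
  ∑ k ∈ range N, (k : ℤ_[p])⁻¹ʳ ^ s

section RestrictedHarmonic

variable {p : ℕ} [hp : Fact p.Prime]

theorem two_mul_restrictedHarmonic {s N : ℕ} (hN : p ∣ N) :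
    2 * restrictedHarmonic p s N =
      ∑ k ∈ range N, ((k : ℤ_[p])⁻¹ʳ ^ s + (-(k : ℤ_[p]) + N)⁻¹ʳ ^ s) := by
  have hends : ((0 : ℕ) : ℤ_[p])⁻¹ʳ ^ s = (N : ℤ_[p])⁻¹ʳ ^ s := by
    rw [Nat.cast_zero, Ring.inverse_zero,
      Ring.inverse_non_unit _ (padicInt_natCast_mem_nonunits_iff.2 hN)]
  rw [two_mul, sum_add_distrib, restrictedHarmonic]
  congr 1
  rw [← sum_range_sub_of_eq (f := fun k : ℕ ↦ (k : ℤ_[p])⁻¹ʳ ^ s) hends]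
  refine sum_congr rfl fun k hk ↦ ?_
  rw [Nat.cast_sub (mem_range.1 hk).le, sub_eq_neg_add]

theorem natCast_dvd_restrictedHarmonic (hp2 : p ≠ 2) {s N : ℕ} (hs : Odd s) (hN : p ∣ N) :
    (N : ℤ_[p]) ∣ restrictedHarmonic p s N := by
  rw [← (padicInt_isUnit_two hp2).dvd_mul_left, two_mul_restrictedHarmonic hN]
  refine dvd_sum fun k _ ↦ ?_
  have hsum : (N : ℤ_[p]) ∣ (k : ℤ_[p])⁻¹ʳ + (-(k : ℤ_[p]) + N)⁻¹ʳ := by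
    have h := dvd_ringInverse_add_sub (x := -(k : ℤ_[p])) (padicInt_natCast_mem_nonunits_iff.2 hN)
    rwa [ringInverse_neg, sub_neg_eq_add, add_comm] at h
  exact hsum.trans (hs.add_dvd_pow_add_pow _ _)

theorem cube_dvd_two_mul_restrictedHarmonic_one_add (hp2 : p ≠ 2) {N : ℕ} (hN : p ∣ N) :
    (N : ℤ_[p]) ^ 3 ∣ 2 * restrictedHarmonic p 1 N + N * restrictedHarmonic p 2 N := by
  have hexpand : (N : ℤ_[p]) ^ 3 ∣ 2 * restrictedHarmonic p 1 N + N * restrictedHarmonic p 2 N +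
      N ^ 2 * restrictedHarmonic p 3 N := by
    rw [two_mul_restrictedHarmonic hN, restrictedHarmonic, restrictedHarmonic, mul_sum,
      mul_sum, ← sum_add_distrib, ← sum_add_distrib]
    refine dvd_sum fun k _ ↦ ?_
    convert cube_dvd_ringInverse_add_sub (x := -(k : ℤ_[p]))
      (padicInt_natCast_mem_nonunits_iff.2 hN) using 1
    rw [ringInverse_neg]
    ring
  refine (dvd_add_left ?_).1 hexpand
  rw [pow_succ]
  exact mul_dvd_mul_left _ (natCast_dvd_restrictedHarmonic hp2 (by decide) hN)

theorem pow_dvd_restrictedHarmonic_one_of_pow_dvd_two (hp2 : p ≠ 2) {a N : ℕ} (ha : a ≠ 0)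
    (hN : p ^ a ∣ N) (h : (p : ℤ_[p]) ^ (a + 1) ∣ restrictedHarmonic p 2 N) :
    (p : ℤ_[p]) ^ (2 * a + 1) ∣ restrictedHarmonic p 1 N := by
  have hNa : (p : ℤ_[p]) ^ a ∣ N := by exact_mod_cast Nat.cast_dvd_cast (α := ℤ_[p]) hN
  rw [← (padicInt_isUnit_two hp2).dvd_mul_left]
  refine (dvd_add_left ?_).1 (dvd_trans ?_ (cube_dvd_two_mul_restrictedHarmonic_one_add hp2
    ((dvd_pow_self p ha).trans hN)))
  · rw [show 2 * a + 1 = a + (a + 1) by ring, pow_add]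
    exact mul_dvd_mul hNa h
  · refine dvd_trans ?_ (pow_dvd_pow_of_dvd hNa 3)
    rw [← pow_mul]
    exact pow_dvd_pow _ (by grind)

theorem cube_dvd_restrictedHarmonic_two_mul_sub {L : ℕ} (hL : p ∣ L) (m : ℕ) :
    (L : ℤ_[p]) ^ 3 ∣ restrictedHarmonic p 2 (L * m) - (m * restrictedHarmonic p 2 L -
      2 * L * (∑ j ∈ range m, (j : ℤ_[p]) ^ 1) * restrictedHarmonic p 3 L +
      3 * L ^ 2 * (∑ j ∈ range m, (j : ℤ_[p]) ^ 2) * restrictedHarmonic p 4 L) := by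
  have hblock (j : ℕ) : (L : ℤ_[p]) ^ 3 ∣ ∑ i ∈ range L, ((i + L * j : ℕ) : ℤ_[p])⁻¹ʳ ^ 2 -
      (restrictedHarmonic p 2 L - 2 * (L * j) * restrictedHarmonic p 3 L +
        3 * (L * j) ^ 2 * restrictedHarmonic p 4 L) := by
    simp only [restrictedHarmonic, mul_sum, ← sum_sub_distrib, ← sum_add_distrib]
    refine dvd_sum fun i _ ↦ ?_
    push_cast
    refine dvd_trans ⟨(j : ℤ_[p]) ^ 3, mul_pow _ _ _⟩ (cube_dvd_ringInverse_add_sq_sub ?_)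
    exact_mod_cast padicInt_natCast_mem_nonunits_iff.2 (hL.mul_right j)
  rw [restrictedHarmonic, sum_range_mul_eq_sum_blocks]
  convert dvd_sum fun j (_ : j ∈ range m) ↦ hblock j using 1
  simp only [sum_sub_distrib, sum_add_distrib, sum_const, card_range, nsmul_eq_mul, mul_sum,
    sum_mul, pow_one]
  congr 2
  · congr 1
    exact sum_congr rfl fun j _ ↦ by ring
  · exact sum_congr rfl fun j _ ↦ by ring

theorem sq_dvd_restrictedHarmonic_two_mul_sub (hp2 : p ≠ 2) {L : ℕ} (hL : p ∣ L) (m : ℕ) :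
    (L : ℤ_[p]) ^ 2 ∣ restrictedHarmonic p 2 (L * m) - m * restrictedHarmonic p 2 L := by
  obtain ⟨w, hw⟩ := cube_dvd_restrictedHarmonic_two_mul_sub hL m
  obtain ⟨v, hv⟩ := natCast_dvd_restrictedHarmonic hp2 (s := 3) (by decide) hL
  rw [hv] at hw
  exact ⟨L * w - 2 * (∑ j ∈ range m, (j : ℤ_[p]) ^ 1) * v +
    3 * (∑ j ∈ range m, (j : ℤ_[p]) ^ 2) * restrictedHarmonic p 4 L, by linear_combination hw⟩

theorem mul_sq_dvd_restrictedHarmonic_two_mul_prime_sub (hp3 : 3 < p) {L : ℕ} (hL : p ∣ L) :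
    (p * L ^ 2 : ℤ_[p]) ∣ restrictedHarmonic p 2 (L * p) - p * restrictedHarmonic p 2 L := by
  obtain ⟨c, rfl⟩ := hL
  obtain ⟨w, hw⟩ := cube_dvd_restrictedHarmonic_two_mul_sub (dvd_mul_right p c) p
  obtain ⟨v, hv⟩ := natCast_dvd_restrictedHarmonic (s := 3) (by grind) (by decide)
    (dvd_mul_right p c)
  obtain ⟨s₁, hs₁⟩ := natCast_dvd_sum_range_pow (p := p) (e := 1) (by grind) p
  obtain ⟨s₂, hs₂⟩ := natCast_dvd_sum_range_pow (p := p) (e := 2) (by grind) p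
  rw [hv, hs₁, hs₂] at hw
  push_cast at hw ⊢
  exact ⟨c * w - 2 * s₁ * v + 3 * s₂ * restrictedHarmonic p 4 (p * c),
    by linear_combination hw⟩

theorem pow_dvd_restrictedHarmonic_two (hp3 : 3 < p)
    (h : (p : ℤ_[p]) ^ 2 ∣ restrictedHarmonic p 2 p) (a n : ℕ) :
    (p : ℤ_[p]) ^ (a + 2) ∣ restrictedHarmonic p 2 (p ^ (a + 1) * n) := by
  have hpow : (p : ℤ_[p]) ^ (a + 2) ∣ restrictedHarmonic p 2 (p ^ (a + 1)) := by
    induction a with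
    | zero => simpa using h
    | succ a ih =>
      have hblock := mul_sq_dvd_restrictedHarmonic_two_mul_prime_sub hp3
        (dvd_pow_self p a.succ_ne_zero)
      rw [← pow_succ] at hblock
      refine (dvd_sub_left ?_).1 (dvd_trans ?_ hblock)
      · rw [add_right_comm, pow_succ']
        exact mul_dvd_mul_left _ ih
      · push_cast
        rw [← pow_mul, ← pow_succ']
        exact pow_dvd_pow _ (by grind)
  refine (dvd_sub_left (hpow.mul_left n)).1 (dvd_trans ?_
    (sq_dvd_restrictedHarmonic_two_mul_sub (by grind) (dvd_pow_self p a.succ_ne_zero) n))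
  push_cast
  rw [← pow_mul]
  exact pow_dvd_pow _ (by grind)

end RestrictedHarmonic

section WolstenholmePrime

variable {p : ℕ} [hp : Fact p.Prime]

theorem padicInt_dvd_pow_prime_sub_self (x : ℤ_[p]) : (p : ℤ_[p]) ∣ x ^ p - x := by
  rw [← Ideal.mem_span_singleton, ← PadicInt.maximalIdeal_eq_span_p, ← PadicInt.ker_toZMod,
    RingHom.mem_ker, map_sub, map_pow, ZMod.pow_card, sub_self]

theorem sq_dvd_ringInverse_pow_prime_sub {x y : ℤ_[p]} (h : (p : ℤ_[p]) ∣ x - y) :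
    (p : ℤ_[p]) ^ 2 ∣ x⁻¹ʳ ^ p - y⁻¹ʳ ^ p := by
  have hinv : (p : ℤ_[p]) ∣ x⁻¹ʳ - y⁻¹ʳ := by
    refine h.trans ?_
    simpa using dvd_ringInverse_add_sub (x := y) (padicInt_mem_nonunits_iff_dvd.2 h)
  simpa using dvd_sub_pow_of_dvd_sub hinv 1

theorem sq_dvd_pow_sub_one_mul_restrictedHarmonic {c : ℕ} (hc : p.Coprime c) (s : ℕ) :
    (p : ℤ_[p]) ^ 2 ∣ ((c : ℤ_[p]) ^ (p * s) - 1) * restrictedHarmonic p (p * s) p := by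
  have hcu : (c : ℤ_[p]) * (c : ℤ_[p])⁻¹ʳ = 1 := Ring.mul_inverse_cancel _
    (padicInt_isUnit_natCast_iff.2 ((Nat.Prime.coprime_iff_not_dvd hp.out).1 hc))
  have hperm : restrictedHarmonic p (p * s) p =
      ∑ i ∈ range p, ((c * i % p : ℕ) : ℤ_[p])⁻¹ʳ ^ (p * s) :=
    (sum_range_mul_mod hc fun k ↦ (k : ℤ_[p])⁻¹ʳ ^ (p * s)).symm
  rw [sub_mul, one_mul]
  nth_rw 1 [hperm]
  rw [restrictedHarmonic, mul_sum, ← sum_sub_distrib]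
  refine dvd_sum fun i _ ↦ ?_
  have hmod : (p : ℤ_[p]) ∣ ((c * i % p : ℕ) : ℤ_[p]) - c * i := by
    rw [← dvd_neg, neg_sub]
    exact ⟨(c * i / p : ℕ), by rw [sub_eq_iff_eq_add']; exact_mod_cast (Nat.mod_add_div _ _).symm⟩
  have hpow := (sq_dvd_ringInverse_pow_prime_sub hmod).trans (sub_dvd_pow_sub_pow _ _ s)
  rw [← pow_mul, ← pow_mul, Ring.mul_inverse_rev, mul_pow] at hpow
  convert hpow.mul_left ((c : ℤ_[p]) ^ (p * s)) using 1
  have hcpow : (c : ℤ_[p]) ^ (p * s) * (c : ℤ_[p])⁻¹ʳ ^ (p * s) = 1 := by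
    rw [← mul_pow, hcu, one_pow]
  linear_combination (i : ℤ_[p])⁻¹ʳ ^ (p * s) * hcpow

theorem sq_dvd_restrictedHarmonic_prime_mul_two (hp3 : 3 < p) :
    (p : ℤ_[p]) ^ 2 ∣ restrictedHarmonic p (p * 2) p := by
  have hunit : IsUnit ((2 : ℕ) ^ (p * 2) - 1 : ℤ_[p]) := by
    by_contra h
    have hdvd := dvd_sub (padicInt_mem_nonunits_iff_dvd.1 h)
      (padicInt_dvd_pow_prime_sub_self (2 ^ 2 : ℤ_[p]))
    refine padicInt_mem_nonunits_iff_dvd.2 hdvd ?_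
    convert padicInt_isUnit_natCast_iff.2 (Nat.not_dvd_of_pos_of_lt three_pos hp3) using 1
    rw [← pow_mul, mul_comm 2 p]
    push_cast
    ring
  exact (hunit.dvd_mul_left).1 (sq_dvd_pow_sub_one_mul_restrictedHarmonic
    ((Nat.coprime_primes hp.out Nat.prime_two).2 (by grind)) 2)

-- With `x ^ (e + 2) = 1 + δ` the two powers are `u² (1 + δ)` and `u² (1 + δ)⁻²`, so the weights `2`
-- and `1` cancel the terms linear in `δ`.
theorem sq_dvd_three_mul_sq_sub_of_mul_eq_one {R : Type*} [CommRing R] {π x u : R} {e : ℕ}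
    (hxu : x * u = 1) (h : π ∣ x ^ (e + 2) - 1) :
    π ^ 2 ∣ 3 * u ^ 2 - 2 * x ^ e - u ^ ((e + 3) * 2) := by
  obtain ⟨z, hz⟩ := h
  obtain ⟨w, hw⟩ : ∃ w, w = u ^ (e + 2) := ⟨_, rfl⟩
  have hxw : x ^ (e + 2) * w = 1 := by rw [hw, ← mul_pow, hxu, one_pow]
  have hxe : x ^ e = x ^ (e + 2) * u ^ 2 := by
    rw [pow_add, mul_assoc, ← mul_pow, hxu, one_pow, mul_one]
  have hue : u ^ ((e + 3) * 2) = u ^ 2 * w ^ 2 := by rw [hw]; ring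
  have hwz : w * (1 + π * z) = 1 := by rw [← hz]; linear_combination hxw
  refine ⟨-(u ^ 2 * z ^ 2 * (2 * w + w ^ 2)), ?_⟩
  rw [hxe, hue, sub_eq_iff_eq_add.1 hz]
  linear_combination u ^ 2 * (w * (π * z - 1) + 2 * (π * z) - 1) * hwz

theorem sq_dvd_three_mul_ringInverse_sq_sub (hp5 : 5 ≤ p) (k : ℕ) :
    (p : ℤ_[p]) ^ 2 ∣
      3 * (k : ℤ_[p])⁻¹ʳ ^ 2 - 2 * (k : ℤ_[p]) ^ (p - 3) - (k : ℤ_[p])⁻¹ʳ ^ (p * 2) := by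
  by_cases hk : p ∣ k
  · rw [Ring.inverse_non_unit _ (padicInt_natCast_mem_nonunits_iff.2 hk), zero_pow two_ne_zero,
      zero_pow (by grind), mul_zero, zero_sub, sub_zero, dvd_neg]
    exact ((pow_dvd_pow _ (by grind)).trans
      (pow_dvd_pow_of_dvd (Nat.cast_dvd_cast hk) (p - 3))).mul_left 2
  · have hku := padicInt_isUnit_natCast_iff.2 hk
    have hfermat : (p : ℤ_[p]) ∣ (k : ℤ_[p]) ^ (p - 3 + 2) - 1 := by
      rw [← hku.dvd_mul_left, mul_sub, ← pow_succ', mul_one, show p - 3 + 2 + 1 = p by grind]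
      exact padicInt_dvd_pow_prime_sub_self _
    have h := sq_dvd_three_mul_sq_sub_of_mul_eq_one (Ring.mul_inverse_cancel _ hku) hfermat
    rwa [Nat.sub_add_cancel (by grind)] at h

end WolstenholmePrime

namespace IsWolstenholmePrime

variable {p : ℕ}

theorem five_le (hW : IsWolstenholmePrime p) : 5 ≤ p := by
  by_contra! hlt
  have h2 := hW.1.two_le
  have hbernoulli : p - 3 = 0 := by
    have h4 : p ≠ 4 := by
      rintro rfl
      exact absurd hW.1 (by decide)
    grind
  have hdvd := hW.2
  rw [hbernoulli, bernoulli_zero, Rat.num_one] at hdvd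
  exact hW.1.one_lt.ne' (by exact_mod_cast Int.eq_one_of_dvd_one (by positivity) hdvd)

variable [hp : Fact p.Prime]

theorem sq_dvd_restrictedHarmonic_two (hW : IsWolstenholmePrime p) :
    (p : ℤ_[p]) ^ 2 ∣ restrictedHarmonic p 2 p := by
  have hp5 := hW.five_le
  have hcongr : (p : ℤ_[p]) ^ 2 ∣ 3 * restrictedHarmonic p 2 p -
      2 * ∑ k ∈ range p, (k : ℤ_[p]) ^ (p - 3) - restrictedHarmonic p (p * 2) p := by
    simp only [restrictedHarmonic, mul_sum, ← sum_sub_distrib]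
    exact dvd_sum fun k _ ↦ sq_dvd_three_mul_ringInverse_sq_sub hp5 k
  have hbernoulli := sq_dvd_sum_range_pow_of_dvd_bernoulli (by grind) hW.2
  have hthree : IsUnit (3 : ℤ_[p]) := by
    exact_mod_cast padicInt_isUnit_natCast_iff.2 (Nat.not_dvd_of_pos_of_lt three_pos (by grind))
  rw [← hthree.dvd_mul_left, ← dvd_sub_left (hbernoulli.mul_left 2),
    ← dvd_sub_left (sq_dvd_restrictedHarmonic_prime_mul_two (by grind))]
  exact hcongr

theorem pow_dvd_restrictedHarmonic_one (hW : IsWolstenholmePrime p) (m n : ℕ) :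
    (p : ℤ_[p]) ^ (2 * m + 3) ∣ restrictedHarmonic p 1 (p ^ (m + 1) * n) := by
  have hp5 := hW.five_le
  exact pow_dvd_restrictedHarmonic_one_of_pow_dvd_two (by grind) m.succ_ne_zero (dvd_mul_right _ n)
    (pow_dvd_restrictedHarmonic_two (by grind) hW.sq_dvd_restrictedHarmonic_two m n)

end IsWolstenholmePrime

section Harmonic

variable {p : ℕ} [hp : Fact p.Prime]

theorem cast_harmonic_eq_sum_range_inv_add (n : ℕ) :
    (harmonic n : ℚ_[p]) = ∑ k ∈ range n, (k : ℚ_[p])⁻¹ + (n : ℚ_[p])⁻¹ := by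
  rw [← sum_range_succ (fun k : ℕ ↦ (k : ℚ_[p])⁻¹), sum_range_succ', harmonic]
  simp

theorem sum_range_prime_mul_inv (N : ℕ) :
    ∑ k ∈ range (p * N), (k : ℚ_[p])⁻¹ =
      (∑ k ∈ range N, (k : ℚ_[p])⁻¹) / p + (restrictedHarmonic p 1 (p * N) : ℚ_[p]) := by
  simp only [restrictedHarmonic, pow_one]
  rw [PadicInt.coe_sum, ← sub_eq_iff_eq_add, ← sum_sub_distrib, sum_range_mul_eq_sum_blocks,
    sum_div]
  refine sum_congr rfl fun j _ ↦ ?_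
  rw [sum_eq_single_of_mem 0 (mem_range.2 hp.out.pos)]
  · rw [padicInt_coe_inverse_natCast, zero_add, if_pos (dvd_mul_right p j), sub_zero, Nat.cast_mul,
      mul_inv_rev, div_eq_mul_inv]
  · intro i hi hi0
    have hndvd : ¬p ∣ i + p * j := by
      rw [Nat.dvd_add_left (dvd_mul_right p j)]
      exact Nat.not_dvd_of_pos_of_lt (Nat.pos_of_ne_zero hi0) (mem_range.1 hi)
    rw [padicInt_coe_inverse_natCast, if_neg hndvd, sub_self]

theorem cast_harmonic_prime_mul (N : ℕ) :
    (harmonic (p * N) : ℚ_[p]) = harmonic N / p + (restrictedHarmonic p 1 (p * N) : ℚ_[p]) := by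
  rw [cast_harmonic_eq_sum_range_inv_add, cast_harmonic_eq_sum_range_inv_add,
    sum_range_prime_mul_inv, Nat.cast_mul, mul_inv_rev]
  ring

theorem harmonic_pow_mul_ne_zero {b n : ℕ} (hb : b ≠ 0) (hn : n ≠ 0) (k : ℕ) :
    harmonic (b ^ k * n) ≠ 0 :=
  (harmonic_pos (mul_ne_zero (pow_ne_zero k hb) hn)).ne'

end Harmonic

section PadicValuation

variable {p : ℕ} [hp : Fact p.Prime]

theorem padic_addValuation_ratCast {q : ℚ} (hq : q ≠ 0) :
    Padic.addValuation (q : ℚ_[p]) = (padicValRat p q : WithTop ℤ) := by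
  rw [Padic.addValuation.apply (Rat.cast_ne_zero.2 hq), Padic.valuation_ratCast]

theorem le_padic_addValuation_of_pow_dvd {x : ℤ_[p]} {t : ℕ} (h : (p : ℤ_[p]) ^ t ∣ x) :
    ((t : ℤ) : WithTop ℤ) ≤ Padic.addValuation (x : ℚ_[p]) := by
  by_cases hx : x = 0
  · rw [hx, PadicInt.coe_zero, AddValuation.map_zero]
    exact le_top
  · rw [Padic.addValuation.apply (mt PadicInt.coe_eq_zero.1 hx), PadicInt.valuation_coe,
      WithTop.coe_le_coe, Nat.cast_le, ← PadicInt.mem_span_pow_iff_le_valuation x hx,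
      Ideal.mem_span_singleton]
    exact h

variable {q r : ℚ} {x : ℤ_[p]} {t : ℕ}

theorem padicValRat_eq_of_cast_eq_add (hq : q ≠ 0) (hr : r ≠ 0) (h : (r : ℚ_[p]) = q + x)
    (hx : (p : ℤ_[p]) ^ t ∣ x) (hqt : padicValRat p q < t) :
    padicValRat p r = padicValRat p q := by
  have hlt : Padic.addValuation (q : ℚ_[p]) < Padic.addValuation (x : ℚ_[p]) := by
    rw [padic_addValuation_ratCast hq]
    exact (WithTop.coe_lt_coe.2 hqt).trans_le (le_padic_addValuation_of_pow_dvd hx)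
  rw [← WithTop.coe_inj, ← padic_addValuation_ratCast hq, ← padic_addValuation_ratCast hr, h,
    AddValuation.map_add_eq_of_lt_left _ hlt]

theorem le_padicValRat_of_cast_eq_add (hq : q ≠ 0) (hr : r ≠ 0) (h : (r : ℚ_[p]) = q + x)
    (hx : (p : ℤ_[p]) ^ t ∣ x) (hqt : t ≤ padicValRat p q) : t ≤ padicValRat p r := by
  rw [← WithTop.coe_le_coe, ← padic_addValuation_ratCast hr, h]
  refine AddValuation.map_le_add _ ?_ (le_padic_addValuation_of_pow_dvd hx)
  rw [padic_addValuation_ratCast hq]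
  exact WithTop.coe_le_coe.2 hqt

theorem padicValRat_div_prime (hq : q ≠ 0) : padicValRat p (q / p) = padicValRat p q - 1 := by
  rw [padicValRat.div hq (Nat.cast_ne_zero.2 hp.out.ne_zero), padicValRat.self hp.out.one_lt]

end PadicValuation

namespace IsWolstenholmePrime

variable {p n : ℕ} [hp : Fact p.Prime]

theorem exists_cast_harmonic_pow_succ_mul (hW : IsWolstenholmePrime p) (m n : ℕ) :
    ∃ x : ℤ_[p], (harmonic (p ^ (m + 1) * n) : ℚ_[p]) = (harmonic (p ^ m * n) / p : ℚ) + x ∧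
      (p : ℤ_[p]) ^ (2 * m + 3) ∣ x := by
  refine ⟨_, ?_, hW.pow_dvd_restrictedHarmonic_one m n⟩
  rw [pow_succ', mul_assoc, cast_harmonic_prime_mul, Rat.cast_div, Rat.cast_natCast]

theorem padicValRat_harmonic_pow_succ_mul (hW : IsWolstenholmePrime p) (hn : n ≠ 0) (m : ℕ)
    (h : padicValRat p (harmonic (p ^ m * n)) ≤ 2 * m + 3) :
    padicValRat p (harmonic (p ^ (m + 1) * n)) = padicValRat p (harmonic (p ^ m * n)) - 1 := by
  have hne (k : ℕ) := harmonic_pow_mul_ne_zero hp.out.ne_zero hn k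
  obtain ⟨x, hx, hdvd⟩ := hW.exists_cast_harmonic_pow_succ_mul m n
  rw [← padicValRat_div_prime (hne m)]
  refine padicValRat_eq_of_cast_eq_add
    (div_ne_zero (hne m) (Nat.cast_ne_zero.2 hp.out.ne_zero)) (hne _) hx hdvd ?_
  rw [padicValRat_div_prime (hne m)]
  push_cast
  linarith

theorem le_padicValRat_harmonic_pow_succ_mul (hW : IsWolstenholmePrime p) (hn : n ≠ 0) (m : ℕ)
    (h : 2 * m + 4 ≤ padicValRat p (harmonic (p ^ m * n))) :
    2 * m + 3 ≤ padicValRat p (harmonic (p ^ (m + 1) * n)) := by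
  have hne (k : ℕ) := harmonic_pow_mul_ne_zero hp.out.ne_zero hn k
  obtain ⟨x, hx, hdvd⟩ := hW.exists_cast_harmonic_pow_succ_mul m n
  refine le_padicValRat_of_cast_eq_add (t := 2 * m + 3)
    (div_ne_zero (hne m) (Nat.cast_ne_zero.2 hp.out.ne_zero)) (hne _) hx hdvd ?_
  rw [padicValRat_div_prime (hne m)]
  push_cast
  linarith

end IsWolstenholmePrime

section ValuationSequence

variable {x : ℕ → ℤ}

theorem eq_sub_of_step {c : ℕ → ℤ} (hc : Monotone c)
    (hstep : ∀ m, x m ≤ c m → x (m + 1) = x m - 1) {a : ℕ} (ha : x a ≤ c a) (k : ℕ) :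
    x (a + k) = x a - k := by
  induction k with
  | zero => simp
  | succ k ih =>
    have hle : x (a + k) ≤ c (a + k) := by
      have := hc (Nat.le_add_right a k)
      omega
    rw [← add_assoc, hstep _ hle, ih]
    push_cast
    ring

theorem exists_le_of_step {c : ℕ → ℤ} (hc : Monotone c)
    (hstep : ∀ m, x m ≤ c m → x (m + 1) = x m - 1) {a : ℕ} (ha : x a ≤ c a) (b : ℤ) :
    ∃ m, x m ≤ b :=
  ⟨a + (x a - b).toNat, by rw [eq_sub_of_step hc hstep ha]; omega⟩

theorem exists_eq_sub_of_step (hstep : ∀ m : ℕ, x m ≤ 2 * m + 3 → x (m + 1) = x m - 1)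
    (hlow : ∀ m : ℕ, 2 * m + 4 ≤ x m → 2 * m + 3 ≤ x (m + 1)) (h0 : 4 ≤ x 0)
    (hex : ∃ m, x m ≤ 3) :
    ∃ a M : ℕ, 3 * a + 1 ≤ M ∧ M ≤ 3 * a + 3 ∧ (∀ m < a, 2 * m + 4 ≤ x m) ∧
      ∀ m, a ≤ m → x m = M - m := by
  obtain ⟨a, ha, hmin⟩ : ∃ a : ℕ, x a ≤ 2 * a + 3 ∧ ∀ m < a, ¬x m ≤ 2 * m + 3 :=
    have hex' : ∃ m : ℕ, x m ≤ 2 * m + 3 := hex.imp fun m hm ↦ by omega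
    ⟨Nat.find hex', Nat.find_spec hex', fun m ↦ Nat.find_min hex'⟩
  obtain ⟨b, rfl⟩ : ∃ b, a = b + 1 := Nat.exists_eq_add_one_of_ne_zero (by grind)
  have hb : 2 * b + 3 ≤ x (b + 1) := hlow b (by grind)
  refine ⟨b + 1, b + 1 + (x (b + 1)).toNat, by grind, by grind, by grind, fun m hm ↦ ?_⟩
  obtain ⟨k, rfl⟩ := Nat.exists_eq_add_of_le hm
  rw [eq_sub_of_step (c := fun m ↦ 2 * m + 3) (fun i j hij ↦ by grind) hstep ha]
  grind

theorem cast_le_sub_one_div_three_sub_one_iff {m M : ℕ} :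
    (m : ℚ) ≤ ((M : ℚ) - 1) / 3 - 1 ↔ 3 * m + 4 ≤ M := by
  rw [← Nat.cast_le (α := ℚ)]
  push_cast
  constructor <;> intro h <;> linarith

end ValuationSequence

theorem mainTheorem2_general (p n : ℕ) (hp : IsWolstenholmePrime p) (hn : n ≠ 0) :
    (padicValRat p (harmonic n) = 3 →
      padicValRat p (harmonic (p * n)) = 2 ∧
        ∀ m : ℕ, padicValRat p (harmonic (p ^ m * (p * n))) = 2 - (m : ℤ)) ∧
    (4 ≤ padicValRat p (harmonic n) →
      (¬ ∃ m : ℕ, padicValRat p (harmonic (p ^ m * n)) ≤ 3) →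
        ∀ m : ℕ, 2 * (m : ℤ) + 4 ≤ padicValRat p (harmonic (p ^ m * n))) ∧
    (4 ≤ padicValRat p (harmonic n) →
      (∃ m : ℕ, padicValRat p (harmonic (p ^ m * n)) ≤ 3) →
        ∃ M : ℕ, padicValRat p (harmonic (p ^ M * n)) = 0 ∧
          ∀ m : ℕ,
            ((m : ℚ) ≤ ((M : ℚ) - 1) / 3 - 1 →
              2 * (m : ℤ) + 4 ≤ padicValRat p (harmonic (p ^ m * n))) ∧
            (((M : ℚ) - 1) / 3 - 1 < (m : ℚ) →
              padicValRat p (harmonic (p ^ m * n)) = (M : ℤ) - (m : ℤ))) := by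
  have : Fact p.Prime := ⟨hp.1⟩
  let x (m : ℕ) : ℤ := padicValRat p (harmonic (p ^ m * n))
  have hx0 : x 0 = padicValRat p (harmonic n) := by simp only [x, pow_zero, one_mul]
  have hstep (m : ℕ) := hp.padicValRat_harmonic_pow_succ_mul hn m
  have hlow (m : ℕ) := hp.le_padicValRat_harmonic_pow_succ_mul hn m
  have hmono : Monotone fun m : ℕ ↦ 2 * (m : ℤ) + 3 := fun i j hij ↦ by grind
  rw [← hx0]
  refine ⟨fun h3 ↦ ?_, fun _ hno m ↦ ?_, fun h4 hex ↦ ?_⟩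
  · have hdrop (m : ℕ) : padicValRat p (harmonic (p ^ m * (p * n))) = 2 - m := by
      have h := eq_sub_of_step (x := x) hmono hstep (a := 0) (by simp [h3]) (m + 1)
      rw [← mul_assoc, ← pow_succ]
      grind
    exact ⟨by simpa using hdrop 0, hdrop⟩
  · by_contra! hlt
    exact hno (exists_le_of_step (x := x) hmono hstep (a := m) (by grind) 3)
  · obtain ⟨a, M, hMa, haM, hhigh, hdrop⟩ := exists_eq_sub_of_step (x := x) hstep hlow h4 hex
    refine ⟨M, (hdrop M (by grind)).trans (sub_self _), fun m ↦ ?_⟩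
    rw [← not_le, cast_le_sub_one_div_three_sub_one_iff]
    exact ⟨fun hm ↦ hhigh m (by grind), fun hm ↦ hdrop m (by grind)⟩

theorem mainTheorem2 (p n : ℕ) (hp5 : 5 ≤ p) (hp : IsWolstenholmePrime p) (hpn : ¬ p ∣ n)
    (hn : 3 ≤ padicValRat p (harmonic n)) :
    (padicValRat p (harmonic n) = 3 →
      padicValRat p (harmonic (p * n)) = 2 ∧
        ∀ m : ℕ, padicValRat p (harmonic (p ^ m * (p * n))) = 2 - (m : ℤ)) ∧
    (4 ≤ padicValRat p (harmonic n) →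
      (¬ ∃ m : ℕ, padicValRat p (harmonic (p ^ m * n)) ≤ 3) →
        ∀ m : ℕ, 2 * (m : ℤ) + 4 ≤ padicValRat p (harmonic (p ^ m * n))) ∧
    (4 ≤ padicValRat p (harmonic n) →
      (∃ m : ℕ, padicValRat p (harmonic (p ^ m * n)) ≤ 3) →
        ∃ M : ℕ, padicValRat p (harmonic (p ^ M * n)) = 0 ∧
          ∀ m : ℕ,
            ((m : ℚ) ≤ ((M : ℚ) - 1) / 3 - 1 →
              2 * (m : ℤ) + 4 ≤ padicValRat p (harmonic (p ^ m * n))) ∧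
            (((M : ℚ) - 1) / 3 - 1 < (m : ℚ) →
              padicValRat p (harmonic (p ^ m * n)) = (M : ℤ) - (m : ℤ))) :=
  mainTheorem2_general p n hp fun hn0 ↦ hpn (hn0 ▸ dvd_zero p)
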